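/- Let $\mathcal T$ be a finite conforming triangulation (an abstract two-dimensional simplicial complex whose triangles are determined by their vertices), for example one of a closed surface, with geometric realization $|\mathcal T|$ and degree-$k$ Lagrange nodes $1,\dots,N$ (the points whose barycentric coordinates are multiples of $1/k$). A nodal vector $\mathbf x=(x_1,\dots,x_N)^T$ with $x_j\in\mathbb R^3$ defines, by piecewise polynomial Lagrange interpolation of degree $k$ from the plane reference triangle, a surface $\Gamma_h[\mathbf x]\subset\mathbb R^3$ made of curved triangles. Assume that it is non-degenerate, that is, the interpolation $|\mathcal T|\to\Gamma_h[\mathbf x]$ is one-to-one and its derivative has rank two on each closed triangle. Then $\Gamma_h[\mathbf x]$ carries the finite element basis functions $\phi_1[\mathbf x],\dots,\phi_N[\mathbf x]$, which satisfy $\phi_i[\mathbf x](x_j)=\delta_{ij}$ and are, pulled back to the reference triangle, polynomials of degree at most $k$. The mass and stiffness matrices consist of the $3\times3$ blocks $$\mathbf M_{ij}(\mathbf x)=I_3\int_{\Gamma_h[\mathbf x]}\phi_i[\mathbf x]\,\phi_j[\mathbf x],\qquad \mathbf A_{ij}(\mathbf x)=I_3\int_{\Gamma_h[\mathbf x]}\nabla_{\Gamma_h[\mathbf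 x]}\phi_i[\mathbf x]\cdot\nabla_{\Gamma_h[\mathbf x]}\phi_j[\mathbf x].$$ Here $\nabla_\Gamma$ is the tangential gradient (taken on each curved triangle), for a vector-valued $u=(u_1,u_2,u_3)^T$ the matrix $\nabla_\Gamma u=(\nabla_\Gamma u_1,\nabla_\Gamma u_2,\nabla_\Gamma u_3)$ has the columns $\nabla_\Gamma u_j$, $\nabla_\Gamma\cdot u=\mathrm{tr}(\nabla_\Gamma u)$, and $A:B=\mathrm{tr}(A^TB)$. Let $\mathbf x,\mathbf x^*$ be nodal vectors, $\mathbf e=\mathbf x-\mathbf x^*$, $\mathbf x^\theta=(1-\theta)\mathbf x^*+\theta\mathbf x$, and suppose that the intermediate surface $\Gamma_h^\theta=\Gamma_h[\mathbf x^\theta]$ is non-degenerate for every $\theta\in[0,1]$. For a nodal vector $\mathbf w$ let $w_h^\theta=\sum_j w_j\phi_j[\mathbf x^\theta]$ on $\Gamma_h^\theta$; in particular $e_h^\theta=\sum_j e_j\phi_j[\mathbf x^\theta]$. Then for all nodal vectors $\mathbf w,\mathbf z$ $$\mathbf w^T(\mathbf M(\mathbf x)-\mathbf M(\mathbf x^*))\mathbf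 z=\int_0^1\int_{\Gamma_h^\theta}w_h^\theta\cdot(\nabla_{\Gamma_h^\theta}\cdot e_h^\theta)\,z_h^\theta\;d\theta,$$ $$\mathbf w^T\big(\mathbf A(\mathbf x)\mathbf x-\mathbf A(\mathbf x^*)\mathbf x^*\big)=\int_0^1\int_{\Gamma_h^\theta}\Big(\nabla_{\Gamma_h^\theta}w_h^\theta:(D_{\Gamma_h^\theta}e_h^\theta)\nabla_{\Gamma_h^\theta}\mathrm{id}+\nabla_{\Gamma_h^\theta}w_h^\theta:\nabla_{\Gamma_h^\theta}e_h^\theta\Big)\,d\theta,$$ where $D_{\Gamma_h^\theta}e_h^\theta=\mathrm{tr}(E^\theta)I_3-(E^\theta+(E^\theta)^T)$ with $E^\theta=\nabla_{\Gamma_h^\theta}e_h^\theta$. In both identities the integrand is integrable on $\Gamma_h^\theta$ for every $\theta\in[0,1]$, and the inner integral is an integrable function of $\theta\in[0,1]$. -/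

import Mathlib

open scoped Matrix Kronecker

noncomputable section

/-- A finite conforming triangulation with vertex set `V` and triangles indexed by `ι`, as an
abstract two-dimensional simplicial complex: each triangle has three distinct (ordered) vertices
and is determined by its vertex set, so that two distinct triangles share nothing, one vertex,
or one edge. Closedness (every edge lies in exactly two triangles) is not imposed: the
triangulations of closed surfaces are among those considered. -/
structure Triangulation (V ι : Type*) where
  /-- the three vertices of a triangle -/
  vert : ι → Fin 3 → V
  vert_injective : ∀ t, Function.Injective (vert t)
  range_injective : Function.Injective fun t => Set.range (vert t)

/-- The plane reference triangle `{ξ ∈ ℝ² : ξ₀ ≥ 0, ξ₁ ≥ 0, ξ₀ + ξ₁ ≤ 1}`. -/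
def refTriangle : Set (Fin 2 → ℝ) := {ξ | 0 ≤ ξ 0 ∧ 0 ≤ ξ 1 ∧ ξ 0 + ξ 1 ≤ 1}

/-- The Frobenius product `A : B = tr(Aᵀ B)`. -/
def frob (A B : Matrix (Fin 3) (Fin 3) ℝ) : ℝ := (Aᵀ * B).trace

namespace Triangulation

variable {V ι : Type*}

/-- The geometric realization of the triangulation, in barycentric coordinates: a point is a
convex combination of the vertices of some triangle. -/
def realization [Fintype V] (T : Triangulation V ι) : Set (V → ℝ) :=
  {l | (∀ v, 0 ≤ l v) ∧ ∑ v, l v = 1 ∧ ∃ t, ∀ v, l v ≠ 0 → v ∈ Set.range (T.vert t)}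

/-- The affine map from the reference plane that sends the reference triangle onto the triangle
`t` of the geometric realization. -/
def chart [DecidableEq V] (T : Triangulation V ι) (t : ι) (ξ : Fin 2 → ℝ) : V → ℝ :=
  Pi.single (T.vert t 0) (1 - ξ 0 - ξ 1) + Pi.single (T.vert t 1) (ξ 0)
    + Pi.single (T.vert t 2) (ξ 1)

variable [Fintype V] [DecidableEq V] [Fintype ι]

open Classical in
/-- The Lagrange nodes of degree `k`: the node `a : V → ℕ`, with `∑ v, a v = k` and supported on
a triangle, is the point of the geometric realization with barycentric coordinates `a v / k`. -/
def nodes (T : Triangulation V ι) (k : ℕ) : Finset (V → ℕ) :=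
  (Finset.piAntidiag Finset.univ k).filter
    fun a => ∃ t, ∀ v, a v ≠ 0 → v ∈ Set.range (T.vert t)

/-- The index set `{1, …, N}` of the nodes. -/
abbrev Node (T : Triangulation V ι) (k : ℕ) : Type _ := {a : V → ℕ // a ∈ T.nodes k}

/-- Nodal vectors `x = (x₁, …, x_N)ᵀ` with `x_j ∈ ℝ³`, that is, vectors of length `3 N`. -/
abbrev NodalVector (T : Triangulation V ι) (k : ℕ) : Type _ := T.Node k × Fin 3 → ℝ

variable {T : Triangulation V ι} {k : ℕ}

/-- The Lagrange shape function of degree `k` of a node, on the geometric realization: on each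
triangle it is the polynomial of degree at most `k` in the barycentric coordinates which is `1`
at the node `a` and `0` at all other nodes. -/
def shape (a : T.Node k) (l : V → ℝ) : ℝ :=
  ∏ v, ∏ j ∈ Finset.range (a.1 v), ((k : ℝ) * l v - j) / ((a.1 v : ℝ) - j)

/-- The piecewise polynomial interpolation of a nodal vector on the geometric realization. -/
def position (x : T.NodalVector k) (l : V → ℝ) : Fin 3 → ℝ :=
  ∑ a : T.Node k, shape a l • fun c => x (a, c)

/-- The surface `Γ_h[x] ⊆ ℝ³` that is defined by the nodal vector `x`. -/
def surface (x : T.NodalVector k) : Set (Fin 3 → ℝ) := position x '' T.realization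

/-- The polynomial parametrization of a curved triangle of `Γ_h[x]` over the reference
triangle. -/
def param (x : T.NodalVector k) (t : ι) (ξ : Fin 2 → ℝ) : Fin 3 → ℝ := position x (T.chart t ξ)

/-- `Γ_h[x]` is a well-defined surface with non-degenerate mesh: the interpolation is one-to-one
on the geometric realization, and each curved triangle is parametrized with a derivative of rank
two on the closed reference triangle. -/
structure Nondegenerate (x : T.NodalVector k) : Prop where
  injOn : Set.InjOn (position x) T.realization
  immersion : ∀ t, ∀ ξ ∈ refTriangle, Function.Injective (fderiv ℝ (param x t) ξ)

/-- The finite element basis function `φ_a[x]` on `Γ_h[x]`, the shape function of the node `a`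
transported to `Γ_h[x]` (only its values on `Γ_h[x]` are meaningful). -/
def basis (x : T.NodalVector k) (a : T.Node k) (p : Fin 3 → ℝ) : ℝ :=
  shape a (Function.invFunOn (position x) T.realization p)

/-- The finite element function `∑ w_j φ_j[x]` on `Γ_h[x]` with nodal vector `w`. -/
def feFun (x w : T.NodalVector k) (p : Fin 3 → ℝ) : Fin 3 → ℝ :=
  ∑ a : T.Node k, basis x a p • fun c => w (a, c)

/-- The `3 × 2` Jacobian matrix of the parametrization of a curved triangle. -/
def jac (x : T.NodalVector k) (t : ι) (ξ : Fin 2 → ℝ) : Matrix (Fin 3) (Fin 2) ℝ :=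
  Matrix.of fun i c => fderiv ℝ (param x t) ξ (Pi.single c 1) i

/-- The first fundamental form `JᵀJ` of a curved triangle. -/
def gram (x : T.NodalVector k) (t : ι) (ξ : Fin 2 → ℝ) : Matrix (Fin 2) (Fin 2) ℝ :=
  (jac x t ξ)ᵀ * jac x t ξ

/-- The surface tangential gradient `∇_Γ u = J (JᵀJ)⁻¹ ∇(u ∘ X)`, at the point `p` of the curved
triangle `t` (with parametrization `X`) of `Γ = Γ_h[x]`, of a scalar function `u` on `Γ`. -/
def tgrad (x : T.NodalVector k) (t : ι) (u : (Fin 3 → ℝ) → ℝ) (p : Fin 3 → ℝ) : Fin 3 → ℝ :=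
  let ξ := Function.invFunOn (param x t) refTriangle p
  jac x t ξ *ᵥ ((gram x t ξ)⁻¹ *ᵥ
    fun c => fderivWithin ℝ (fun η => u (param x t η)) refTriangle ξ (Pi.single c 1))

/-- The tangential gradient of a vector-valued function, the matrix with columns `∇_Γ u_j`. -/
def tgradVec (x : T.NodalVector k) (t : ι) (u : (Fin 3 → ℝ) → Fin 3 → ℝ) (p : Fin 3 → ℝ) :
    Matrix (Fin 3) (Fin 3) ℝ :=
  Matrix.of fun i j => tgrad x t (fun q => u q j) p i

/-- The surface divergence `∇_Γ · u = ∑ i, (∇_Γ u_i)_i`. -/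
def tdiv (x : T.NodalVector k) (t : ι) (u : (Fin 3 → ℝ) → Fin 3 → ℝ) (p : Fin 3 → ℝ) : ℝ :=
  ∑ i, tgrad x t (fun q => u q i) p i

/-- `D_Γ u = tr(E) I₃ - (E + Eᵀ)` with `E = ∇_Γ u`. -/
def tD (x : T.NodalVector k) (t : ι) (u : (Fin 3 → ℝ) → Fin 3 → ℝ) (p : Fin 3 → ℝ) :
    Matrix (Fin 3) (Fin 3) ℝ :=
  let E := tgradVec x t u p
  E.trace • (1 : Matrix (Fin 3) (Fin 3) ℝ) - (E + Eᵀ)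

/-- The surface integral over `Γ_h[x]` of an elementwise defined function (`f t p` is its value
at the point `p` of the curved triangle `t`), with area element `√det(JᵀJ)`. -/
def surfaceIntegral (x : T.NodalVector k) (f : ι → (Fin 3 → ℝ) → ℝ) : ℝ :=
  ∑ t, ∫ ξ in refTriangle, f t (param x t ξ) * √(gram x t ξ).det

/-- Integrability over `Γ_h[x]` of an elementwise defined function. -/
def SurfaceIntegrable (x : T.NodalVector k) (f : ι → (Fin 3 → ℝ) → ℝ) : Prop :=
  ∀ t, MeasureTheory.IntegrableOn (fun ξ => f t (param x t ξ) * √(gram x t ξ).det) refTriangle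

/-- The mass matrix, with blocks `M_ij(x) = I₃ ∫_{Γ_h[x]} φ_i[x] φ_j[x]`. -/
def mass (x : T.NodalVector k) : Matrix (T.Node k × Fin 3) (T.Node k × Fin 3) ℝ :=
  (Matrix.of fun i j => surfaceIntegral x fun _ p => basis x i p * basis x j p) ⊗ₖ
    (1 : Matrix (Fin 3) (Fin 3) ℝ)

/-- The stiffness matrix, with blocks `A_ij(x) = I₃ ∫_{Γ_h[x]} ∇_Γ φ_i[x] · ∇_Γ φ_j[x]`. -/
def stiffness (x : T.NodalVector k) : Matrix (T.Node k × Fin 3) (T.Node k × Fin 3) ℝ :=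
  (Matrix.of fun i j => surfaceIntegral x fun t p =>
    tgrad x t (basis x i) p ⬝ᵥ tgrad x t (basis x j) p) ⊗ₖ (1 : Matrix (Fin 3) (Fin 3) ℝ)

/-- The nodal vector `x^θ = (1 - θ) x* + θ x` of the intermediate surface `Γ_h^θ`. -/
def intermediate (xs x : T.NodalVector k) (θ : ℝ) : T.NodalVector k := (1 - θ) • xs + θ • x

/-- The integrand `w_h^θ · (∇ · e_h^θ) z_h^θ` on `Γ_h^θ`, where `e = x - x*`. -/
def massIntegrand (xs x w z : T.NodalVector k) (θ : ℝ) (t : ι) (p : Fin 3 → ℝ) : ℝ :=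
  let y := intermediate xs x θ
  feFun y w p ⬝ᵥ (tdiv y t (feFun y (x - xs)) p • feFun y z p)

/-- The integrand `∇w_h^θ : (D e_h^θ) ∇id + ∇w_h^θ : ∇e_h^θ` on `Γ_h^θ`, where `e = x - x*`. -/
def stiffnessIntegrand (xs x w : T.NodalVector k) (θ : ℝ) (t : ι) (p : Fin 3 → ℝ) : ℝ :=
  let y := intermediate xs x θ
  frob (tgradVec y t (feFun y w) p)
      (tD y t (feFun y (x - xs)) p * tgradVec y t (fun q => q) p)
    + frob (tgradVec y t (feFun y w) p) (tgradVec y t (feFun y (x - xs)) p)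

end Triangulation

end

/-! On a non-degenerate surface the basis functions pull back to shape functions on the reference
triangle that do not depend on the nodal vector (`Nondegenerate.basis_param`). The pulled-back
integrals therefore depend on θ only through the Jacobian J of the parametrization, and J is affine
in θ with derivative J', the Jacobian of e (`jac_intermediate`).

With G = JᵀJ, the gradient of a finite element function with Jacobian W is J G⁻¹ Wᵀ
(`Nondegenerate.tgradVec_param`). The mass form has density (w · z)√det G, and Jacobi's formula
gives (√det G)' = tr(J G⁻¹ J'ᵀ)√det G, where the trace is the divergence of e. Since id has nodal
vector x, the form wᵀA(x)x has density tr(W G⁻¹ Jᵀ)√det G. In its product rule √det G contributes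
the trace part of D, G⁻¹ contributes -(E + Eᵀ), and Jᵀ contributes ∇w : ∇e
(`hasDerivAt_trace_mul_inv_mul_sqrt`).

All densities and derivatives are continuous on the compact set [0,1] × triangle, so the fundamental
theorem of calculus in θ and Fubini finish the proof. -/

open MeasureTheory in
/-- Differentiation under the integral over a compact set, in integrated form. -/
theorem integral_sub_integral_eq_of_hasDerivAt {E : Type*} [TopologicalSpace E] [MeasurableSpace E]
    [OpensMeasurableSpace E] {μ : Measure E} [SFinite μ] [IsFiniteMeasureOnCompacts μ]
    {K : Set E} (hK : IsCompact K) (hKm : MeasurableSet K) {F F' : ℝ → E → ℝ}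
    (hF : ∀ ξ ∈ K, ∀ θ ∈ Set.Icc (0 : ℝ) 1, HasDerivAt (fun s => F s ξ) (F' θ ξ) θ)
    (hF' : ContinuousOn (fun q : ℝ × E => F' q.1 q.2) (Set.Icc 0 1 ×ˢ K))
    (h0 : IntegrableOn (F 0) K μ) (h1 : IntegrableOn (F 1) K μ) :
    (∀ θ ∈ Set.Icc (0 : ℝ) 1, IntegrableOn (F' θ) K μ) ∧
      IntervalIntegrable (fun θ => ∫ ξ in K, F' θ ξ ∂μ) volume 0 1 ∧
      ∫ ξ in K, F 1 ξ ∂μ - ∫ ξ in K, F 0 ξ ∂μ = ∫ θ in (0 : ℝ)..1, ∫ ξ in K, F' θ ξ ∂μ := by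
  have hint : IntegrableOn (fun q : ℝ × E => F' q.1 q.2) (Set.Icc 0 1 ×ˢ K) (volume.prod μ) := by
    exact hF'.integrableOn_compact' (isCompact_Icc.prod hK) (measurableSet_Icc.prod hKm)
  have hint' : Integrable (fun q : ℝ × E => F' q.1 q.2)
      ((volume.restrict (Set.Ioc 0 1)).prod (μ.restrict K)) := by
    rw [Measure.prod_restrict]
    exact hint.mono_set (Set.prod_mono Set.Ioc_subset_Icc_self subset_rfl)
  have hslice : ∀ ξ ∈ K, ContinuousOn (fun θ => F' θ ξ) (Set.Icc 0 1) := fun ξ hξ =>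
    hF'.comp (f := fun θ => (θ, ξ)) (by fun_prop) fun θ hθ => ⟨hθ, hξ⟩
  refine ⟨fun θ hθ => ?_, ?_, ?_⟩
  · exact ContinuousOn.integrableOn_compact' hK hKm
      (hF'.comp (f := fun ξ => (θ, ξ)) (by fun_prop) fun ξ hξ => ⟨hθ, hξ⟩)
  · rw [intervalIntegrable_iff_integrableOn_Ioc_of_le zero_le_one]
    exact hint'.integral_prod_left
  -- Fubini puts the θ-integral inside, where the fundamental theorem applies for each fixed ξ.
  · rw [intervalIntegral.integral_of_le zero_le_one, integral_integral_swap hint',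
      ← integral_sub h1 h0]
    refine setIntegral_congr_fun hKm fun ξ hξ => ?_
    rw [← intervalIntegral.integral_of_le zero_le_one]
    refine (intervalIntegral.integral_eq_sub_of_hasDerivAt (f := fun s => F s ξ) ?_ ?_).symm
    · rw [Set.uIcc_of_le zero_le_one]; exact hF ξ hξ
    · exact ContinuousOn.intervalIntegrable (by
        rw [Set.uIcc_of_le zero_le_one]; exact hslice ξ hξ)

/-! ### Calculus of determinants and inverses of 2 × 2 matrices -/

/-- Singular matrices need no exclusion: both sides are then zero by convention. -/
theorem Matrix.inv_fin_two_apply {G : Matrix (Fin 2) (Fin 2) ℝ} :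
    G⁻¹ = G.det⁻¹ • !![G 1 1, -G 0 1; -G 1 0, G 0 0] := by
  rw [Matrix.inv_def, Ring.inverse_eq_inv', Matrix.adjugate_fin_two]

theorem HasDerivAt.det_fin_two {G : ℝ → Matrix (Fin 2) (Fin 2) ℝ}
    {G' : Matrix (Fin 2) (Fin 2) ℝ} {θ : ℝ}
    (hG : ∀ i j, HasDerivAt (fun s => G s i j) (G' i j) θ) :
    HasDerivAt (fun s => (G s).det)
      (G' 0 0 * G θ 1 1 + G θ 0 0 * G' 1 1 - (G' 0 1 * G θ 1 0 + G θ 0 1 * G' 1 0)) θ := by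
  simp only [Matrix.det_fin_two]
  exact ((hG 0 0).mul (hG 1 1)).sub ((hG 0 1).mul (hG 1 0))

/-- Follows from the cofactor formula and the quotient rule. Working entrywise avoids choosing a
norm on matrices. -/
theorem HasDerivAt.matrix_inv_fin_two {G : ℝ → Matrix (Fin 2) (Fin 2) ℝ}
    {G' : Matrix (Fin 2) (Fin 2) ℝ} {θ : ℝ}
    (hG : ∀ i j, HasDerivAt (fun s => G s i j) (G' i j) θ) (hdet : (G θ).det ≠ 0) (i j : Fin 2) :
    HasDerivAt (fun s => (G s)⁻¹ i j) ((-((G θ)⁻¹ * G' * (G θ)⁻¹)) i j) θ := by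
  have hd := HasDerivAt.det_fin_two hG
  have hi := hd.inv hdet
  have hdet' := hdet
  rw [Matrix.det_fin_two] at hdet'
  simp only [Matrix.inv_fin_two_apply]
  fin_cases i <;> fin_cases j
  · refine (hi.mul (hG 1 1)).congr_deriv ?_
    simp [Matrix.mul_apply, Fin.sum_univ_two, Matrix.det_fin_two, -Matrix.cons_mul]
    field_simp
    ring
  · refine (hi.mul (hG 0 1).neg).congr_deriv ?_
    simp [Matrix.mul_apply, Fin.sum_univ_two, Matrix.det_fin_two, -Matrix.cons_mul]
    field_simp
    ring
  · refine (hi.mul (hG 1 0).neg).congr_deriv ?_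
    simp [Matrix.mul_apply, Fin.sum_univ_two, Matrix.det_fin_two, -Matrix.cons_mul]
    field_simp
    ring
  · refine (hi.mul (hG 0 0)).congr_deriv ?_
    simp [Matrix.mul_apply, Fin.sum_univ_two, Matrix.det_fin_two, -Matrix.cons_mul]
    field_simp
    ring

/-- Jacobi's formula (det G)' = det G · tr(G⁻¹G') combined with the chain rule for the square root.
-/
theorem HasDerivAt.sqrt_det_fin_two {G : ℝ → Matrix (Fin 2) (Fin 2) ℝ}
    {G' : Matrix (Fin 2) (Fin 2) ℝ} {θ : ℝ}
    (hG : ∀ i j, HasDerivAt (fun s => G s i j) (G' i j) θ) (hdet : 0 < (G θ).det) :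
    HasDerivAt (fun s => √(G s).det) (((G θ)⁻¹ * G').trace / 2 * √(G θ).det) θ := by
  have hd := HasDerivAt.det_fin_two hG
  refine (hd.sqrt hdet.ne').congr_deriv ?_
  have h2 : (G θ).det * ((G θ)⁻¹ * G').trace =
      G' 0 0 * G θ 1 1 + G θ 0 0 * G' 1 1 - (G' 0 1 * G θ 1 0 + G θ 0 1 * G' 1 0) := by
    rw [Matrix.inv_fin_two_apply, Matrix.smul_mul, Matrix.trace_smul, smul_eq_mul,
      mul_inv_cancel_left₀ hdet.ne']
    simp [Matrix.mul_apply, Matrix.trace, Fin.sum_univ_two, -Matrix.cons_mul]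
    ring
  rw [← h2]
  have h3 := Real.sq_sqrt hdet.le
  have h4 := (Real.sqrt_pos.2 hdet).ne'
  field_simp
  rw [h3, mul_comm]

/-! ### First variation of the area element and of the Dirichlet density -/

theorem Matrix.gram_det_pos {J : Matrix (Fin 3) (Fin 2) ℝ} (hJ : Function.Injective J.mulVec) :
    0 < (Jᵀ * J).det := by
  have := Matrix.PosDef.conjTranspose_mul_self J hJ
  rw [Matrix.conjTranspose_eq_transpose_of_trivial] at this
  exact this.det_pos

theorem HasDerivAt.transpose_mul_self {J : ℝ → Matrix (Fin 3) (Fin 2) ℝ}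
    {J' : Matrix (Fin 3) (Fin 2) ℝ} {θ : ℝ}
    (hJ : ∀ i j, HasDerivAt (fun s => J s i j) (J' i j) θ) (i j : Fin 2) :
    HasDerivAt (fun s => ((J s)ᵀ * J s) i j) ((J'ᵀ * J θ + (J θ)ᵀ * J') i j) θ := by
  simp only [Matrix.mul_apply, Matrix.transpose_apply, Matrix.add_apply,
    ← Finset.sum_add_distrib]
  exact HasDerivAt.fun_sum fun l _ => (hJ l i).mul (hJ l j)

/-- The derivative of the area element is the area element times the surface divergence. -/
theorem HasDerivAt.sqrt_det_transpose_mul_self {J : ℝ → Matrix (Fin 3) (Fin 2) ℝ}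
    {J' : Matrix (Fin 3) (Fin 2) ℝ} {θ : ℝ}
    (hJ : ∀ i j, HasDerivAt (fun s => J s i j) (J' i j) θ)
    (hdet : 0 < ((J θ)ᵀ * J θ).det) {G : Matrix (Fin 2) (Fin 2) ℝ} (hG : G = (J θ)ᵀ * J θ) :
    HasDerivAt (fun s => √((J s)ᵀ * J s).det) ((J θ * G⁻¹ * J'ᵀ).trace * √G.det) θ := by
  refine (HasDerivAt.sqrt_det_fin_two (HasDerivAt.transpose_mul_self hJ) hdet).congr_deriv ?_
  rw [← hG]
  have hGi : (G⁻¹)ᵀ = G⁻¹ := by rw [Matrix.transpose_nonsing_inv, hG]; simp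
  -- As G⁻¹ is symmetric, the two halves of (JᵀJ)' have equal traces against it, which absorbs the
  -- factor 1/2.
  have a1 : (G⁻¹ * ((J θ)ᵀ * J')).trace = (G⁻¹ * (J'ᵀ * J θ)).trace := by
    rw [← Matrix.trace_transpose, Matrix.transpose_mul, hGi, Matrix.trace_mul_comm,
      Matrix.transpose_mul, Matrix.transpose_transpose]
  have a2 : (G⁻¹ * (J'ᵀ * J θ)).trace = (J θ * G⁻¹ * J'ᵀ).trace := by
    rw [← Matrix.mul_assoc, Matrix.trace_mul_comm, Matrix.mul_assoc]
  rw [Matrix.mul_add, Matrix.trace_add, a1, a2]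
  ring

/-- The algebraic core of the stiffness identity: `E`, `P`, `U` stand for the tangential gradients
of e, id and w, and the three varying factors produce the three parts of the integrand. -/
theorem hasDerivAt_trace_mul_inv_mul_sqrt {J : ℝ → Matrix (Fin 3) (Fin 2) ℝ}
    {J' W : Matrix (Fin 3) (Fin 2) ℝ} {θ : ℝ}
    (hJ : ∀ i j, HasDerivAt (fun s => J s i j) (J' i j) θ)
    (hdet : 0 < ((J θ)ᵀ * J θ).det) {G : Matrix (Fin 2) (Fin 2) ℝ} (hG : G = (J θ)ᵀ * J θ)
    {E P U : Matrix (Fin 3) (Fin 3) ℝ} (hE : E = J θ * G⁻¹ * J'ᵀ) (hP : P = J θ * G⁻¹ * (J θ)ᵀ)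
    (hU : U = J θ * G⁻¹ * Wᵀ) :
    HasDerivAt (fun s => (W * ((J s)ᵀ * J s)⁻¹ * (J s)ᵀ).trace * √((J s)ᵀ * J s).det)
      ((frob U ((E.trace • (1 : Matrix (Fin 3) (Fin 3) ℝ) - (E + Eᵀ)) * P) + frob U E) *
        √G.det) θ := by
  have hGd := HasDerivAt.transpose_mul_self hJ
  have hinv := HasDerivAt.matrix_inv_fin_two hGd hdet.ne'
  have hsq := HasDerivAt.sqrt_det_transpose_mul_self hJ hdet hG
  have htr : HasDerivAt (fun s => (W * ((J s)ᵀ * J s)⁻¹ * (J s)ᵀ).trace)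
      ((W * -(G⁻¹ * (J'ᵀ * J θ + (J θ)ᵀ * J') * G⁻¹) * (J θ)ᵀ).trace
        + (W * G⁻¹ * J'ᵀ).trace) θ := by
    subst hG
    -- Only the outer products are expanded, so that the entries of the inverse stay in the form
    -- that `hinv` differentiates.
    simp only [Matrix.trace, Matrix.diag_apply, Matrix.mul_apply (N := (_)ᵀ),
      Matrix.mul_apply (M := W), ← Finset.sum_add_distrib, Matrix.transpose_apply]
    exact HasDerivAt.fun_sum fun l _ => HasDerivAt.fun_sum fun m _ =>
      (HasDerivAt.fun_sum fun n _ => (hinv n m).const_mul (W l n)).mul (hJ l m)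
  refine (htr.mul hsq).congr_deriv ?_
  rw [← hG] at hdet ⊢
  rw [← hE]
  have hGs : Gᵀ = G := by rw [hG]; simp
  have hGi : (G⁻¹)ᵀ = G⁻¹ := by rw [Matrix.transpose_nonsing_inv, hGs]
  have hu : IsUnit G.det := hdet.ne'.isUnit
  have hUt : Uᵀ = W * G⁻¹ * (J θ)ᵀ := by
    rw [hU]; simp [Matrix.transpose_mul, hGi, Matrix.mul_assoc]
  have hEt : Eᵀ = J' * G⁻¹ * (J θ)ᵀ := by
    rw [hE]; simp [Matrix.transpose_mul, hGi, Matrix.mul_assoc]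
  have hcancel : ∀ M : Matrix (Fin 2) (Fin 3) ℝ, (J θ)ᵀ * (J θ * (G⁻¹ * M)) = M := by
    intro M
    rw [← Matrix.mul_assoc, ← hG, ← Matrix.mul_assoc, Matrix.mul_nonsing_inv _ hu,
      Matrix.one_mul]
  have e2 : frob U E = (W * G⁻¹ * J'ᵀ).trace := by
    rw [frob, hUt, hE]
    simp only [Matrix.mul_assoc, hcancel]
  -- `P` is the tangential projection, so UᵀP = Uᵀ. Cancelling JᵀJG⁻¹ turns UᵀEP and UᵀEᵀP into the
  -- two halves of W G⁻¹(JᵀJ)'G⁻¹Jᵀ.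
  have e3 : frob U ((E.trace • (1 : Matrix (Fin 3) (Fin 3) ℝ) - (E + Eᵀ)) * P) =
      E.trace * (W * G⁻¹ * (J θ)ᵀ).trace
        + (W * -(G⁻¹ * (J'ᵀ * J θ + (J θ)ᵀ * J') * G⁻¹) * (J θ)ᵀ).trace := by
    rw [frob, hUt, hEt, Matrix.sub_mul, Matrix.smul_mul, Matrix.one_mul, Matrix.mul_sub,
      Matrix.mul_smul, Matrix.trace_sub, Matrix.trace_smul, smul_eq_mul, hP]
    have b1 : W * G⁻¹ * (J θ)ᵀ * (J θ * G⁻¹ * (J θ)ᵀ) = W * G⁻¹ * (J θ)ᵀ := by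
      simp only [Matrix.mul_assoc, hcancel]
    rw [b1, sub_eq_add_neg, ← Matrix.trace_neg]
    congr 2
    generalize E.trace = τ
    rw [hE]
    simp only [Matrix.mul_assoc, Matrix.add_mul, Matrix.mul_add, Matrix.mul_neg, Matrix.neg_mul,
      hcancel]
  rw [e2, e3]
  ring

theorem Continuous.matrix_nonsing_inv {X n : Type*} [TopologicalSpace X] [Fintype n]
    [DecidableEq n] {G : X → Matrix n n ℝ} (hG : Continuous G) (hdet : ∀ q, (G q).det ≠ 0) :
    Continuous fun q => (G q)⁻¹ := by
  simp only [Matrix.inv_def, Ring.inverse_eq_inv']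
  exact (hG.matrix_det.inv₀ hdet).smul hG.matrix_adjugate

/-! ### Finite sums and block matrices -/

theorem Finset.sum_sum_sum_comm {α β γ : Type*} [Fintype α] [Fintype β] [Fintype γ]
    (f : α → β → γ → ℝ) : ∑ i, ∑ j, ∑ t, f i j t = ∑ t, ∑ i, ∑ j, f i j t :=
  (Finset.sum_congr rfl fun _ _ => Finset.sum_comm).trans Finset.sum_comm

theorem dotProduct_kronecker_one_mulVec {N n : Type*} [Fintype N] [Fintype n] [DecidableEq n]
    (S : Matrix N N ℝ) (w v : N × n → ℝ) :
    w ⬝ᵥ ((S ⊗ₖ (1 : Matrix n n ℝ)) *ᵥ v) = ∑ i, ∑ j, S i j * ∑ c, w (i, c) * v (j, c) := by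
  simp only [dotProduct, Matrix.mulVec, Fintype.sum_prod_type, Matrix.kronecker_apply,
    Matrix.one_apply, mul_ite, mul_one, mul_zero, ite_mul, zero_mul, Finset.sum_ite_eq,
    Finset.mem_univ, if_true, Finset.mul_sum]
  refine Finset.sum_congr rfl fun i _ => ?_
  rw [Finset.sum_comm]
  exact Finset.sum_congr rfl fun j _ => Finset.sum_congr rfl fun c _ => by ring

/-! ### The reference triangle -/

theorem convex_refTriangle : Convex ℝ refTriangle := by
  intro ξ hξ η hη a b ha hb hab
  obtain ⟨h1, h2, h3⟩ := hξ
  obtain ⟨g1, g2, g3⟩ := hη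
  refine ⟨?_, ?_, ?_⟩ <;> simp only [Pi.add_apply, Pi.smul_apply, smul_eq_mul]
  · positivity
  · positivity
  · nlinarith

theorem isClosed_refTriangle : IsClosed refTriangle :=
  (isClosed_le continuous_const (continuous_apply 0)).inter
    ((isClosed_le continuous_const (continuous_apply 1)).inter
      (isClosed_le ((continuous_apply 0).add (continuous_apply 1)) continuous_const))

theorem isCompact_refTriangle : IsCompact refTriangle := by
  refine (isCompact_Icc (a := (0 : Fin 2 → ℝ)) (b := 1)).of_isClosed_subset
    isClosed_refTriangle ?_
  rintro ξ ⟨h1, h2, h3⟩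
  refine ⟨fun i => ?_, fun i => ?_⟩ <;> fin_cases i <;> simp <;> linarith

theorem measurableSet_refTriangle : MeasurableSet refTriangle :=
  isClosed_refTriangle.measurableSet

/-- Ensures that the `fderivWithin` in `tgrad` is the ordinary derivative of any differentiable
extension, also at boundary points. -/
theorem uniqueDiffOn_refTriangle : UniqueDiffOn ℝ refTriangle := by
  refine uniqueDiffOn_convex convex_refTriangle ⟨fun _ => 1 / 4, ?_⟩
  refine mem_interior.2 ⟨{ξ | 0 < ξ 0 ∧ 0 < ξ 1 ∧ ξ 0 + ξ 1 < 1},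
    fun ξ h => ⟨h.1.le, h.2.1.le, h.2.2.le⟩, ?_, by norm_num⟩
  exact (isOpen_lt continuous_const (continuous_apply 0)).inter
    ((isOpen_lt continuous_const (continuous_apply 1)).inter
      (isOpen_lt ((continuous_apply 0).add (continuous_apply 1)) continuous_const))

/-! ### Charts, shape functions and Jacobians -/

namespace Triangulation

variable {V ι : Type*} [DecidableEq V]

theorem chart_apply (T : Triangulation V ι) (t : ι) (ξ : Fin 2 → ℝ) (v : V) :
    T.chart t ξ v = (if v = T.vert t 0 then 1 - ξ 0 - ξ 1 else 0)
      + (if v = T.vert t 1 then ξ 0 else 0) + (if v = T.vert t 2 then ξ 1 else 0) := by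
  simp [chart, Pi.single_apply]

theorem chart_injective (T : Triangulation V ι) (t : ι) : Function.Injective (T.chart t) := by
  intro ξ η h
  have hne : ∀ i j, i ≠ j → T.vert t i ≠ T.vert t j := fun i j hij h =>
    hij (T.vert_injective t h)
  have h1 := congrFun h (T.vert t 1)
  have h2 := congrFun h (T.vert t 2)
  simp only [chart_apply, hne 1 0 (by decide), hne 1 2 (by decide), hne 2 0 (by decide),
    hne 2 1 (by decide), if_true, if_false, zero_add, add_zero] at h1 h2
  ext i
  fin_cases i
  · exact h1
  · exact h2

variable [Fintype V]

theorem chart_mem_realization (T : Triangulation V ι) (t : ι) {ξ : Fin 2 → ℝ}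
    (hξ : ξ ∈ refTriangle) : T.chart t ξ ∈ T.realization := by
  obtain ⟨h1, h2, h3⟩ := hξ
  refine ⟨fun v => ?_, ?_, t, fun v hv => ?_⟩
  · rw [chart_apply]
    have : 0 ≤ 1 - ξ 0 - ξ 1 := by linarith
    positivity
  · simp only [chart_apply, Finset.sum_add_distrib, Finset.sum_ite_eq', Finset.mem_univ, if_true]
    ring
  · by_contra h
    have h' : ∀ i, v ≠ T.vert t i := fun i hi => h ⟨i, hi.symm⟩
    simp [chart_apply, h'] at hv

variable [Fintype ι] {T : Triangulation V ι} {k : ℕ}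

theorem contDiff_shape_chart (a : T.Node k) (t : ι) :
    ContDiff ℝ 1 fun ξ => shape a (T.chart t ξ) := by
  unfold shape
  refine contDiff_prod fun v _ => contDiff_prod fun j _ => ?_
  have : ContDiff ℝ 1 fun ξ => T.chart t ξ v := by
    simp only [chart_apply]
    refine (ContDiff.add ?_ ?_).add ?_ <;> split_ifs <;> fun_prop
  fun_prop

theorem param_apply (x : T.NodalVector k) (t : ι) (ξ : Fin 2 → ℝ) (i : Fin 3) :
    param x t ξ i = ∑ a : T.Node k, shape a (T.chart t ξ) * x (a, i) := by
  simp [param, position, Finset.sum_apply]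

theorem contDiff_param (x : T.NodalVector k) (t : ι) : ContDiff ℝ 1 (param x t) := by
  refine contDiff_pi.2 fun i => ?_
  simp only [param_apply]
  exact ContDiff.sum fun a _ => (contDiff_shape_chart a t).mul contDiff_const

/-- The gradients of the shape functions of a triangle on the reference plane. -/
noncomputable def shapeGrad (T : Triangulation V ι) (k : ℕ) (t : ι) (ξ : Fin 2 → ℝ) :
    Matrix (T.Node k) (Fin 2) ℝ :=
  Matrix.of fun a c => fderiv ℝ (fun η => shape a (T.chart t η)) ξ (Pi.single c 1)

theorem continuous_shapeGrad (t : ι) : Continuous (shapeGrad T k t) := by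
  refine continuous_matrix fun a c => ?_
  exact ((contDiff_shape_chart a t).continuous_fderiv one_ne_zero).clm_apply continuous_const

theorem jac_apply (x : T.NodalVector k) (t : ι) (ξ : Fin 2 → ℝ) (i : Fin 3) (c : Fin 2) :
    jac x t ξ i c = fderiv ℝ (fun η => param x t η i) ξ (Pi.single c 1) := by
  have h := ((contDiff_param x t).differentiable one_ne_zero ξ)
  simp only [jac, Matrix.of_apply]
  rw [fderiv_apply h]
  rfl

/-- Separates the nodal values from the fixed shape gradients, which makes the Jacobian visibly
linear in the nodal vector. -/
theorem jac_eq (x : T.NodalVector k) (t : ι) (ξ : Fin 2 → ℝ) :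
    jac x t ξ = (Matrix.of fun a i => x (a, i))ᵀ * shapeGrad T k t ξ := by
  ext i c
  rw [jac_apply]
  simp only [param_apply]
  have hd : ∀ a : T.Node k, DifferentiableAt ℝ (fun η => shape a (T.chart t η)) ξ := fun a =>
    (contDiff_shape_chart a t).differentiable one_ne_zero ξ
  rw [fderiv_fun_sum fun a _ => (hd a).mul_const _]
  simp [fderiv_mul_const (hd _), Matrix.mul_apply, shapeGrad]

theorem continuous_jac (x : T.NodalVector k) (t : ι) : Continuous (jac x t) := by
  have : jac x t = fun ξ => (Matrix.of fun a i => x (a, i))ᵀ * shapeGrad T k t ξ :=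
    funext (jac_eq x t)
  rw [this]
  exact continuous_const.matrix_mul (continuous_shapeGrad t)

theorem jac_intermediate (xs x : T.NodalVector k) (t : ι) (θ : ℝ) (ξ : Fin 2 → ℝ) :
    jac (intermediate xs x θ) t ξ = jac xs t ξ + θ • jac (x - xs) t ξ := by
  simp only [jac_eq, ← Matrix.smul_mul, ← Matrix.add_mul, ← Matrix.transpose_smul,
    ← Matrix.transpose_add]
  congr 2
  ext a i
  simp [intermediate]
  ring

theorem hasDerivAt_jac_intermediate (xs x : T.NodalVector k) (t : ι) (θ : ℝ) (ξ : Fin 2 → ℝ)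
    (i : Fin 3) (j : Fin 2) :
    HasDerivAt (fun s => jac (intermediate xs x s) t ξ i j) (jac (x - xs) t ξ i j) θ := by
  simp only [jac_intermediate, Matrix.add_apply, Matrix.smul_apply, smul_eq_mul]
  simpa using ((hasDerivAt_id θ).mul_const (jac (x - xs) t ξ i j)).const_add (jac xs t ξ i j)

theorem intermediate_zero (xs x : T.NodalVector k) : intermediate xs x 0 = xs := by
  simp [intermediate]

theorem intermediate_one (xs x : T.NodalVector k) : intermediate xs x 1 = x := by
  simp [intermediate]

/-! ### Pull-back from a non-degenerate surface -/

namespace Nondegenerate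

variable {y : T.NodalVector k}

theorem gram_det_pos (hy : Nondegenerate y) (t : ι) {ξ : Fin 2 → ℝ} (hξ : ξ ∈ refTriangle) :
    0 < (gram y t ξ).det := by
  refine Matrix.gram_det_pos fun v v' h => hy.immersion t ξ hξ ?_
  have key : ∀ v : Fin 2 → ℝ, jac y t ξ *ᵥ v = fderiv ℝ (param y t) ξ v := by
    intro v
    conv_rhs => rw [pi_eq_sum_univ' v, map_sum]
    ext i
    simp [Matrix.mulVec, dotProduct, jac, mul_comm, Finset.sum_apply]
  rw [← key, ← key]
  exact h

theorem injOn_param (hy : Nondegenerate y) (t : ι) : Set.InjOn (param y t) refTriangle :=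
  fun _ hξ _ hη h => T.chart_injective t
    (hy.injOn (T.chart_mem_realization t hξ) (T.chart_mem_realization t hη) h)

/-- The transport property: since the interpolation is one-to-one on the whole realization,
`invFunOn` recovers the barycentric point, and `y` disappears from the right-hand side. -/
theorem basis_param (hy : Nondegenerate y) (a : T.Node k) (t : ι) {ξ : Fin 2 → ℝ}
    (hξ : ξ ∈ refTriangle) : basis y a (param y t ξ) = shape a (T.chart t ξ) := by
  rw [basis, param, hy.injOn.leftInvOn_invFunOn (T.chart_mem_realization t hξ)]

theorem feFun_param (hy : Nondegenerate y) (w : T.NodalVector k) (t : ι) {ξ : Fin 2 → ℝ}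
    (hξ : ξ ∈ refTriangle) : feFun y w (param y t ξ) = param w t ξ := by
  simp only [feFun, hy.basis_param _ t hξ]
  rfl

/-- Agreement with `g` is asked only on the closed triangle, because basis functions are meaningful
only on the surface. -/
theorem tgrad_param (hy : Nondegenerate y) (t : ι) {ξ : Fin 2 → ℝ} (hξ : ξ ∈ refTriangle)
    {u : (Fin 3 → ℝ) → ℝ} {g : (Fin 2 → ℝ) → ℝ} (hg : DifferentiableAt ℝ g ξ)
    (hu : ∀ η ∈ refTriangle, u (param y t η) = g η) :
    tgrad y t u (param y t ξ) =
      jac y t ξ *ᵥ ((gram y t ξ)⁻¹ *ᵥ fun c => fderiv ℝ g ξ (Pi.single c 1)) := by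
  have h : fderivWithin ℝ (fun η => u (param y t η)) refTriangle ξ = fderiv ℝ g ξ := by
    rw [fderivWithin_congr' hu hξ, hg.fderivWithin (uniqueDiffOn_refTriangle ξ hξ)]
  simp only [tgrad, (hy.injOn_param t).leftInvOn_invFunOn hξ, h]

/-- Stated for a general `u` so that it covers both `feFun y w` and the identity, the latter with `w
= y`. -/
theorem tgradVec_param (hy : Nondegenerate y) (w : T.NodalVector k) (t : ι) {ξ : Fin 2 → ℝ}
    (hξ : ξ ∈ refTriangle) {u : (Fin 3 → ℝ) → Fin 3 → ℝ}
    (hu : ∀ η ∈ refTriangle, u (param y t η) = param w t η) :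
    tgradVec y t u (param y t ξ) = jac y t ξ * (gram y t ξ)⁻¹ * (jac w t ξ)ᵀ := by
  ext i j
  have hd : DifferentiableAt ℝ (fun η => param w t η j) ξ :=
    differentiableAt_pi.1 ((contDiff_param w t).differentiable one_ne_zero ξ) j
  rw [tgradVec, Matrix.of_apply, hy.tgrad_param t hξ hd fun η hη => congrFun (hu η hη) j,
    Matrix.mulVec_mulVec]
  simp only [← jac_apply]
  rfl

end Nondegenerate

end Triangulation

/-! ### Mass and stiffness forms as integrals over the reference triangle -/

namespace Triangulation

open MeasureTheory

variable {V ι : Type*} [Fintype V] [DecidableEq V] [Fintype ι] {T : Triangulation V ι} {k : ℕ}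

theorem continuous_gram (y : T.NodalVector k) (t : ι) : Continuous (gram y t) :=
  (continuous_jac y t).matrix_transpose.matrix_mul (continuous_jac y t)

theorem continuous_jac_intermediate (xs x : T.NodalVector k) (t : ι) :
    Continuous fun q : ℝ × (Fin 2 → ℝ) => jac (intermediate xs x q.1) t q.2 := by
  simp only [jac_intermediate]
  exact ((continuous_jac xs t).comp continuous_snd).add
    (continuous_fst.smul ((continuous_jac (x - xs) t).comp continuous_snd))

theorem continuous_gram_intermediate (xs x : T.NodalVector k) (t : ι) :
    Continuous fun q : ℝ × (Fin 2 → ℝ) => gram (intermediate xs x q.1) t q.2 :=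
  (continuous_jac_intermediate xs x t).matrix_transpose.matrix_mul
    (continuous_jac_intermediate xs x t)

theorem continuous_frob {X : Type*} [TopologicalSpace X] {A B : X → Matrix (Fin 3) (Fin 3) ℝ} (hA : Continuous A)
    (hB : Continuous B) : Continuous fun q => frob (A q) (B q) :=
  (hA.matrix_transpose.matrix_mul hB).matrix_trace

/-- Moving J across the product creates JᵀJ, which cancels one of the two inverses. -/
theorem dotProduct_gram_inv {J : Matrix (Fin 3) (Fin 2) ℝ} (hJ : 0 < (Jᵀ * J).det)
    (g h : Fin 2 → ℝ) :
    (J *ᵥ ((Jᵀ * J)⁻¹ *ᵥ g)) ⬝ᵥ (J *ᵥ ((Jᵀ * J)⁻¹ *ᵥ h)) = g ⬝ᵥ ((Jᵀ * J)⁻¹ *ᵥ h) := by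
  have hGi : ((Jᵀ * J)⁻¹)ᵀ = (Jᵀ * J)⁻¹ := by rw [Matrix.transpose_nonsing_inv]; simp
  rw [Matrix.dotProduct_mulVec, ← Matrix.mulVec_transpose, Matrix.mulVec_mulVec,
    Matrix.mulVec_mulVec, Matrix.mul_nonsing_inv _ hJ.ne'.isUnit, Matrix.one_mulVec,
    Matrix.dotProduct_mulVec, ← Matrix.mulVec_transpose, hGi]

/-- A block matrix of surface integrals acts on nodal vectors as the surface integral of the
assembled bilinear form. -/
theorem dotProduct_surfaceIntegral_kronecker (y w v : T.NodalVector k)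
    (K : T.Node k → T.Node k → ι → (Fin 3 → ℝ) → ℝ)
    (hK : ∀ i j, SurfaceIntegrable y (K i j)) :
    w ⬝ᵥ (((Matrix.of fun i j => surfaceIntegral y (K i j)) ⊗ₖ
        (1 : Matrix (Fin 3) (Fin 3) ℝ)) *ᵥ v) =
      ∑ t, ∫ ξ in refTriangle, (∑ i, ∑ j, K i j t (param y t ξ) * ∑ c, w (i, c) * v (j, c)) *
        √(gram y t ξ).det := by
  rw [dotProduct_kronecker_one_mulVec]
  simp only [Matrix.of_apply, surfaceIntegral, Finset.sum_mul (Finset.univ (α := ι))]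
  rw [Finset.sum_sum_sum_comm]
  refine Finset.sum_congr rfl fun t _ => ?_
  have hint : ∀ i j, IntegrableOn (fun ξ => K i j t (param y t ξ) * √(gram y t ξ).det *
      ∑ c, w (i, c) * v (j, c)) refTriangle := fun i j => (hK i j t).mul_const _
  have hrw : ∀ ξ, (∑ i, ∑ j, K i j t (param y t ξ) * ∑ c, w (i, c) * v (j, c)) *
      √(gram y t ξ).det = ∑ i, ∑ j, K i j t (param y t ξ) * √(gram y t ξ).det *
        ∑ c, w (i, c) * v (j, c) := by
    intro ξ
    simp only [Finset.sum_mul (s := (Finset.univ : Finset (T.Node k)))]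
    exact Finset.sum_congr rfl fun i _ => Finset.sum_congr rfl fun j _ => by ring
  simp only [hrw]
  rw [integral_finsetSum _ fun i _ => integrable_finsetSum _ fun j _ => hint i j]
  refine Finset.sum_congr rfl fun i _ => ?_
  rw [integral_finsetSum _ fun j _ => hint i j]
  exact Finset.sum_congr rfl fun j _ => (integral_mul_const _ _).symm

namespace Nondegenerate

variable {y : T.NodalVector k}

theorem continuousOn_gram_inv (hy : Nondegenerate y) (t : ι) :
    ContinuousOn (fun ξ => (gram y t ξ)⁻¹) refTriangle := by
  rw [continuousOn_iff_continuous_domRestrict]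
  exact ((continuous_gram y t).comp continuous_subtype_val).matrix_nonsing_inv
    fun q => (hy.gram_det_pos t q.2).ne'

theorem dotProduct_mass_mulVec (hy : Nondegenerate y) (w z : T.NodalVector k) :
    w ⬝ᵥ (mass y *ᵥ z) = ∑ t, ∫ ξ in refTriangle,
      (param w t ξ ⬝ᵥ param z t ξ) * √(gram y t ξ).det := by
  rw [mass, dotProduct_surfaceIntegral_kronecker]
  · refine Finset.sum_congr rfl fun t _ => ?_
    refine setIntegral_congr_fun measurableSet_refTriangle fun ξ hξ => ?_
    simp only [hy.basis_param _ t hξ, dotProduct, param_apply]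
    congr 1
    simp_rw [Finset.sum_mul_sum, Finset.mul_sum]
    rw [Finset.sum_sum_sum_comm]
    exact Finset.sum_congr rfl fun c _ => Finset.sum_congr rfl fun i _ =>
      Finset.sum_congr rfl fun j _ => by ring
  · intro i j t
    refine IntegrableOn.congr_fun (f := fun ξ => shape i (T.chart t ξ) * shape j (T.chart t ξ) *
      √(gram y t ξ).det) ?_ (fun ξ hξ => ?_) measurableSet_refTriangle
    · refine ContinuousOn.integrableOn_compact' isCompact_refTriangle measurableSet_refTriangle
        (Continuous.continuousOn ?_)
      exact ((contDiff_shape_chart i t).continuous.mul (contDiff_shape_chart j t).continuous).mul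
        (continuous_gram y t).matrix_det.sqrt
    · simp only [hy.basis_param _ t hξ]

theorem tgrad_basis_param (hy : Nondegenerate y) (a : T.Node k) (t : ι) {ξ : Fin 2 → ℝ}
    (hξ : ξ ∈ refTriangle) : tgrad y t (basis y a) (param y t ξ) =
      jac y t ξ *ᵥ ((gram y t ξ)⁻¹ *ᵥ (shapeGrad T k t ξ).row a) :=
  hy.tgrad_param t hξ ((contDiff_shape_chart a t).differentiable one_ne_zero ξ)
    fun _ hη => hy.basis_param a t hη

theorem dotProduct_stiffness_mulVec (hy : Nondegenerate y) (w v : T.NodalVector k) :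
    w ⬝ᵥ (stiffness y *ᵥ v) = ∑ t, ∫ ξ in refTriangle,
      (jac w t ξ * (gram y t ξ)⁻¹ * (jac v t ξ)ᵀ).trace * √(gram y t ξ).det := by
  have hrow : ∀ (t : ι), ∀ ξ ∈ refTriangle, ∀ i j,
      tgrad y t (basis y i) (param y t ξ) ⬝ᵥ tgrad y t (basis y j) (param y t ξ) =
        (shapeGrad T k t ξ * (gram y t ξ)⁻¹ * (shapeGrad T k t ξ)ᵀ) i j := by
    intro t ξ hξ i j
    rw [hy.tgrad_basis_param i t hξ, hy.tgrad_basis_param j t hξ]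
    have hd := hy.gram_det_pos t hξ
    rw [gram] at hd ⊢
    rw [dotProduct_gram_inv hd, Matrix.mul_assoc, Matrix.mul_apply]
    rfl
  rw [stiffness, dotProduct_surfaceIntegral_kronecker]
  · refine Finset.sum_congr rfl fun t _ => ?_
    refine setIntegral_congr_fun measurableSet_refTriangle fun ξ hξ => ?_
    simp only [hrow t ξ hξ]
    congr 1
    rw [jac_eq w, jac_eq v, Matrix.transpose_mul, Matrix.transpose_transpose]
    have : (Matrix.of fun a i => w (a, i))ᵀ * shapeGrad T k t ξ * (gram y t ξ)⁻¹ *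
        ((shapeGrad T k t ξ)ᵀ * Matrix.of fun a i => v (a, i)) =
        (Matrix.of fun a i => w (a, i))ᵀ * ((shapeGrad T k t ξ * (gram y t ξ)⁻¹ *
          (shapeGrad T k t ξ)ᵀ) * Matrix.of fun a i => v (a, i)) := by
      simp only [Matrix.mul_assoc]
    -- Cycling the nodal values of `w` to the end leaves the matrix of gradient products against the
    -- nodal products of `v` and `w`, which is the assembled double sum.
    rw [this, Matrix.trace_mul_comm, Matrix.mul_assoc (_ * _ * (shapeGrad T k t ξ)ᵀ), Matrix.trace]
    refine Finset.sum_congr rfl fun i _ => ?_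
    rw [Matrix.diag_apply, Matrix.mul_apply]
    refine Finset.sum_congr rfl fun j _ => ?_
    congr 1
    simp [Matrix.mul_apply, mul_comm]
  · intro i j t
    refine IntegrableOn.congr_fun (f := fun ξ => (shapeGrad T k t ξ * (gram y t ξ)⁻¹ *
      (shapeGrad T k t ξ)ᵀ) i j * √(gram y t ξ).det) ?_ (fun ξ hξ => ?_) measurableSet_refTriangle
    · refine ContinuousOn.integrableOn_compact' isCompact_refTriangle measurableSet_refTriangle ?_
      rw [continuousOn_iff_continuous_domRestrict]
      have h1 := (continuous_shapeGrad (T := T) (k := k) t).comp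
        (continuous_subtype_val (p := (· ∈ refTriangle)))
      have h2 := continuousOn_iff_continuous_domRestrict.1 (hy.continuousOn_gram_inv t)
      exact (((h1.matrix_mul h2).matrix_mul h1.matrix_transpose).matrix_elem i j).mul
        ((continuous_gram y t).comp continuous_subtype_val).matrix_det.sqrt
    · simp only [hrow t ξ hξ]

end Nondegenerate

/-! ### Integrated first variation on each curved triangle -/

section Evolution

variable {x xs : T.NodalVector k}

/-- Joint continuity is claimed only on [0,1] × triangle, where non-degeneracy keeps the determinant
away from zero. -/
theorem continuous_gram_inv_intermediate
    (hnd : ∀ θ ∈ Set.Icc (0 : ℝ) 1, Nondegenerate (intermediate xs x θ)) (t : ι) :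
    Continuous fun q : ↥(Set.Icc (0 : ℝ) 1 ×ˢ refTriangle) =>
      (gram (intermediate xs x q.1.1) t q.1.2)⁻¹ :=
  ((continuous_gram_intermediate xs x t).comp continuous_subtype_val).matrix_nonsing_inv
    fun q => ((hnd _ q.2.1).gram_det_pos t q.2.2).ne'

theorem massIntegrand_param {θ : ℝ} (h : Nondegenerate (intermediate xs x θ))
    (w z : T.NodalVector k) (t : ι) {ξ : Fin 2 → ℝ} (hξ : ξ ∈ refTriangle) :
    massIntegrand xs x w z θ t (param (intermediate xs x θ) t ξ) =
      (param w t ξ ⬝ᵥ param z t ξ) * (jac (intermediate xs x θ) t ξ *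
        (gram (intermediate xs x θ) t ξ)⁻¹ * (jac (x - xs) t ξ)ᵀ).trace := by
  rw [← h.tgradVec_param (x - xs) t hξ fun η hη => h.feFun_param _ t hη]
  simp only [massIntegrand, h.feFun_param _ t hξ, dotProduct_smul, smul_eq_mul]
  rw [mul_comm]
  rfl

theorem massIntegrand_integral
    (hnd : ∀ θ ∈ Set.Icc (0 : ℝ) 1, Nondegenerate (intermediate xs x θ))
    (w z : T.NodalVector k) (t : ι) :
    (∀ θ ∈ Set.Icc (0 : ℝ) 1, IntegrableOn (fun ξ => massIntegrand xs x w z θ t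
      (param (intermediate xs x θ) t ξ) * √(gram (intermediate xs x θ) t ξ).det) refTriangle) ∧
    IntervalIntegrable (fun θ => ∫ ξ in refTriangle, massIntegrand xs x w z θ t
      (param (intermediate xs x θ) t ξ) * √(gram (intermediate xs x θ) t ξ).det) volume 0 1 ∧
    (∫ ξ in refTriangle, (param w t ξ ⬝ᵥ param z t ξ) * √(gram x t ξ).det) -
      (∫ ξ in refTriangle, (param w t ξ ⬝ᵥ param z t ξ) * √(gram xs t ξ).det) =
      ∫ θ in (0 : ℝ)..1, ∫ ξ in refTriangle, massIntegrand xs x w z θ t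
        (param (intermediate xs x θ) t ξ) * √(gram (intermediate xs x θ) t ξ).det := by
  have hwz : Continuous fun ξ => param w t ξ ⬝ᵥ param z t ξ :=
    (contDiff_param w t).continuous.dotProduct (contDiff_param z t).continuous
  have hint : ∀ θ, IntegrableOn (fun ξ => (param w t ξ ⬝ᵥ param z t ξ) *
      √(gram (intermediate xs x θ) t ξ).det) refTriangle := fun θ =>
    ContinuousOn.integrableOn_compact' isCompact_refTriangle measurableSet_refTriangle
      (hwz.mul (continuous_gram _ t).matrix_det.sqrt).continuousOn
  have key := integral_sub_integral_eq_of_hasDerivAt (μ := volume) isCompact_refTriangle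
    measurableSet_refTriangle
    (F := fun θ ξ => (param w t ξ ⬝ᵥ param z t ξ) * √(gram (intermediate xs x θ) t ξ).det)
    (F' := fun θ ξ => massIntegrand xs x w z θ t (param (intermediate xs x θ) t ξ) *
      √(gram (intermediate xs x θ) t ξ).det) ?_ ?_ (hint 0) (hint 1)
  · simpa only [intermediate_zero, intermediate_one] using key
  · intro ξ hξ θ hθ
    rw [massIntegrand_param (hnd θ hθ) w z t hξ, mul_assoc]
    exact (HasDerivAt.sqrt_det_transpose_mul_self
      (hasDerivAt_jac_intermediate xs x t θ ξ) ((hnd θ hθ).gram_det_pos t hξ) rfl).const_mul _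
  · refine ContinuousOn.congr (f := fun q : ℝ × (Fin 2 → ℝ) =>
      (param w t q.2 ⬝ᵥ param z t q.2) * (jac (intermediate xs x q.1) t q.2 *
        (gram (intermediate xs x q.1) t q.2)⁻¹ * (jac (x - xs) t q.2)ᵀ).trace *
        √(gram (intermediate xs x q.1) t q.2).det) ?_ fun q hq => ?_
    · rw [continuousOn_iff_continuous_domRestrict]
      have h1 := hwz.comp (continuous_snd.comp
        (continuous_subtype_val (p := (· ∈ Set.Icc (0 : ℝ) 1 ×ˢ refTriangle))))
      have h2 := (continuous_jac_intermediate xs x t).comp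
        (continuous_subtype_val (p := (· ∈ Set.Icc (0 : ℝ) 1 ×ˢ refTriangle)))
      have h3 := (continuous_jac (x - xs) t).comp (continuous_snd.comp
        (continuous_subtype_val (p := (· ∈ Set.Icc (0 : ℝ) 1 ×ˢ refTriangle))))
      exact (h1.mul ((h2.matrix_mul (continuous_gram_inv_intermediate hnd t)).matrix_mul
        h3.matrix_transpose).matrix_trace).mul
        ((continuous_gram_intermediate xs x t).comp continuous_subtype_val).matrix_det.sqrt
    · simp only [massIntegrand_param (hnd q.1 hq.1) w z t hq.2]

theorem stiffnessIntegrand_param {θ : ℝ} (h : Nondegenerate (intermediate xs x θ))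
    (w : T.NodalVector k) (t : ι) {ξ : Fin 2 → ℝ} (hξ : ξ ∈ refTriangle)
    {J : Matrix (Fin 3) (Fin 2) ℝ} (hJ : J = jac (intermediate xs x θ) t ξ)
    {G : Matrix (Fin 2) (Fin 2) ℝ} (hG : G = gram (intermediate xs x θ) t ξ)
    {E : Matrix (Fin 3) (Fin 3) ℝ} (hE : E = J * G⁻¹ * (jac (x - xs) t ξ)ᵀ) :
    stiffnessIntegrand xs x w θ t (param (intermediate xs x θ) t ξ) =
      frob (J * G⁻¹ * (jac w t ξ)ᵀ)
        ((E.trace • (1 : Matrix (Fin 3) (Fin 3) ℝ) - (E + Eᵀ)) * (J * G⁻¹ * Jᵀ)) +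
      frob (J * G⁻¹ * (jac w t ξ)ᵀ) E := by
  subst hE hG hJ
  rw [← h.tgradVec_param (x - xs) t hξ fun η hη => h.feFun_param _ t hη,
    ← h.tgradVec_param w t hξ fun η hη => h.feFun_param _ t hη,
    -- The identity of the surface is the finite element function of its own nodal vector.
    ← h.tgradVec_param (intermediate xs x θ) t hξ (u := fun q => q) fun _ _ => rfl]
  rfl

theorem stiffnessIntegrand_integral
    (hnd : ∀ θ ∈ Set.Icc (0 : ℝ) 1, Nondegenerate (intermediate xs x θ))
    (w : T.NodalVector k) (t : ι) :
    (∀ θ ∈ Set.Icc (0 : ℝ) 1, IntegrableOn (fun ξ => stiffnessIntegrand xs x w θ t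
      (param (intermediate xs x θ) t ξ) * √(gram (intermediate xs x θ) t ξ).det) refTriangle) ∧
    IntervalIntegrable (fun θ => ∫ ξ in refTriangle, stiffnessIntegrand xs x w θ t
      (param (intermediate xs x θ) t ξ) * √(gram (intermediate xs x θ) t ξ).det) volume 0 1 ∧
    (∫ ξ in refTriangle, (jac w t ξ * (gram x t ξ)⁻¹ * (jac x t ξ)ᵀ).trace *
        √(gram x t ξ).det) -
      (∫ ξ in refTriangle, (jac w t ξ * (gram xs t ξ)⁻¹ * (jac xs t ξ)ᵀ).trace *
        √(gram xs t ξ).det) =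
      ∫ θ in (0 : ℝ)..1, ∫ ξ in refTriangle, stiffnessIntegrand xs x w θ t
        (param (intermediate xs x θ) t ξ) * √(gram (intermediate xs x θ) t ξ).det := by
  have hint : ∀ θ ∈ Set.Icc (0 : ℝ) 1, IntegrableOn (fun ξ => (jac w t ξ *
      (gram (intermediate xs x θ) t ξ)⁻¹ * (jac (intermediate xs x θ) t ξ)ᵀ).trace *
      √(gram (intermediate xs x θ) t ξ).det) refTriangle := by
    intro θ hθ
    refine ContinuousOn.integrableOn_compact' isCompact_refTriangle measurableSet_refTriangle ?_
    rw [continuousOn_iff_continuous_domRestrict]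
    have h1 := (continuous_jac w t).comp (continuous_subtype_val (p := (· ∈ refTriangle)))
    have h2 := continuousOn_iff_continuous_domRestrict.1 ((hnd θ hθ).continuousOn_gram_inv t)
    have h3 := (continuous_jac (intermediate xs x θ) t).comp
      (continuous_subtype_val (p := (· ∈ refTriangle)))
    exact ((h1.matrix_mul h2).matrix_mul h3.matrix_transpose).matrix_trace.mul
      ((continuous_gram _ t).comp continuous_subtype_val).matrix_det.sqrt
  have key := integral_sub_integral_eq_of_hasDerivAt (μ := volume) isCompact_refTriangle
    measurableSet_refTriangle
    (F := fun θ ξ => (jac w t ξ * (gram (intermediate xs x θ) t ξ)⁻¹ *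
      (jac (intermediate xs x θ) t ξ)ᵀ).trace * √(gram (intermediate xs x θ) t ξ).det)
    (F' := fun θ ξ => stiffnessIntegrand xs x w θ t (param (intermediate xs x θ) t ξ) *
      √(gram (intermediate xs x θ) t ξ).det) ?_ ?_ (hint 0 (by simp)) (hint 1 (by simp))
  · simpa only [intermediate_zero, intermediate_one] using key
  · intro ξ hξ θ hθ
    rw [stiffnessIntegrand_param (hnd θ hθ) w t hξ rfl rfl rfl]
    exact hasDerivAt_trace_mul_inv_mul_sqrt (hasDerivAt_jac_intermediate xs x t θ ξ)
      ((hnd θ hθ).gram_det_pos t hξ) rfl rfl rfl rfl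
  · have h1 := (continuous_jac w t).comp (continuous_snd.comp
      (continuous_subtype_val (p := (· ∈ Set.Icc (0 : ℝ) 1 ×ˢ refTriangle))))
    have h2 := (continuous_jac_intermediate xs x t).comp
      (continuous_subtype_val (p := (· ∈ Set.Icc (0 : ℝ) 1 ×ˢ refTriangle)))
    have h3 := (continuous_jac (x - xs) t).comp (continuous_snd.comp
      (continuous_subtype_val (p := (· ∈ Set.Icc (0 : ℝ) 1 ×ˢ refTriangle))))
    have h4 := h2.matrix_mul (continuous_gram_inv_intermediate hnd t)
    have hU := h4.matrix_mul h1.matrix_transpose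
    have hE := h4.matrix_mul h3.matrix_transpose
    have hP := h4.matrix_mul h2.matrix_transpose
    rw [continuousOn_iff_continuous_domRestrict]
    refine (((continuous_frob hU ((((hE.matrix_trace.smul (continuous_const (y := 1))).sub
      (hE.add hE.matrix_transpose))).matrix_mul hP)).add (continuous_frob hU hE)).mul
      ((continuous_gram_intermediate xs x t).comp
        continuous_subtype_val).matrix_det.sqrt).congr fun q => ?_
    simp only [Set.domRestrict_apply]
    rw [stiffnessIntegrand_param (hnd q.1.1 q.2.1) w t q.2.2 rfl rfl rfl]
    rfl

end Evolution

end Triangulation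

/-! ### Assembly over the triangles -/

open Triangulation in
theorem lemma3p1 {V ι : Type*} [Fintype V] [DecidableEq V] [Fintype ι]
    (T : Triangulation V ι) (k : ℕ) (x xs : T.NodalVector k)
    (hnd : ∀ θ ∈ Set.Icc (0 : ℝ) 1, Nondegenerate (intermediate xs x θ))
    (w z : T.NodalVector k) :
    ((∀ θ ∈ Set.Icc (0 : ℝ) 1,
        SurfaceIntegrable (intermediate xs x θ) (massIntegrand xs x w z θ)) ∧
      IntervalIntegrable
        (fun θ => surfaceIntegral (intermediate xs x θ) (massIntegrand xs x w z θ))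
        MeasureTheory.volume 0 1 ∧
      w ⬝ᵥ ((mass x - mass xs) *ᵥ z) =
        ∫ θ in (0 : ℝ)..1,
          surfaceIntegral (intermediate xs x θ) (massIntegrand xs x w z θ)) ∧
    ((∀ θ ∈ Set.Icc (0 : ℝ) 1,
        SurfaceIntegrable (intermediate xs x θ) (stiffnessIntegrand xs x w θ)) ∧
      IntervalIntegrable
        (fun θ => surfaceIntegral (intermediate xs x θ) (stiffnessIntegrand xs x w θ))
        MeasureTheory.volume 0 1 ∧
      w ⬝ᵥ (stiffness x *ᵥ x - stiffness xs *ᵥ xs) =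
        ∫ θ in (0 : ℝ)..1,
          surfaceIntegral (intermediate xs x θ) (stiffnessIntegrand xs x w θ)) := by
  -- The two given surfaces are the ends θ = 1 and θ = 0 of the path.
  have hx : Nondegenerate x := by simpa [intermediate_one] using hnd 1 (by simp)
  have hxs : Nondegenerate xs := by simpa [intermediate_zero] using hnd 0 (by simp)
  have hm := massIntegrand_integral hnd w z
  have hs := stiffnessIntegrand_integral hnd w
  have hmi := IntervalIntegrable.sum Finset.univ fun t _ => (hm t).2.1
  have hsi := IntervalIntegrable.sum Finset.univ fun t _ => (hs t).2.1
  simp only [Finset.sum_fn] at hmi hsi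
  refine ⟨⟨fun θ hθ t => (hm t).1 θ hθ, hmi, ?_⟩, fun θ hθ t => (hs t).1 θ hθ, hsi, ?_⟩
  · simp only [surfaceIntegral]
    rw [intervalIntegral.integral_finsetSum fun t _ => (hm t).2.1, Matrix.sub_mulVec,
      dotProduct_sub, hx.dotProduct_mass_mulVec, hxs.dotProduct_mass_mulVec,
      ← Finset.sum_sub_distrib]
    exact Finset.sum_congr rfl fun t _ => (hm t).2.2
  · simp only [surfaceIntegral]
    rw [intervalIntegral.integral_finsetSum fun t _ => (hs t).2.1,
      dotProduct_sub, hx.dotProduct_stiffness_mulVec, hxs.dotProduct_stiffness_mulVec,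
      ← Finset.sum_sub_distrib]
    exact Finset.sum_congr rfl fun t _ => (hs t).2.2
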